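/- Let $p_0\in(0,1)$, $p_1,p_2\in(\tfrac12,1]$ (prevalence, sensitivity, specificity) and $1\le x_L<x_U<\infty$. For a real group size $x\in[x_L,x_U]$ put $$\pi(x)=p_1\bigl(1-(1-p_0)^x\bigr)+(1-p_2)(1-p_0)^x,\qquad \lambda(x)=\frac{1}{\pi(x)(1-\pi(x))},$$ $$f(x)=\Bigl(\tfrac{\partial\pi(x)}{\partial p_0},\tfrac{\partial\pi(x)}{\partial p_1},\tfrac{\partial\pi(x)}{\partial p_2}\Bigr)^{\mathrm T}=\bigl(x(p_1+p_2-1)(1-p_0)^{x-1},\;1-(1-p_0)^x,\;-(1-p_0)^x\bigr)^{\mathrm T}.$$ An (approximate) design $\xi=\{(x_i,w_i)\}_{i=1}^k$ on $[x_L,x_U]$ is a finitely supported probability measure with support points $x_1<\dots<x_k$ in $[x_L,x_U]$ and weights $w_i>0$, $\sum_i w_i=1$; its information matrix is $M(\xi)=\sum_{i=1}^k w_i\,\lambda(x_i)f(x_i)f(x_i)^{\mathrm T}$. Let $$\mathcal C_0=\Bigl\{\{(x_i,w_i)\}_{i=1}^3:\ x_L=x_1<x_2<x_3\le x_U,\ \sum_{i=1}^3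 w_i=1,\ w_i\ge 0\Bigr\},$$ where points of weight $0$ are regarded as absent from the design. Then: 1. The class $\mathcal C_0$ is essentially complete: for every design $\xi_1$ on $[x_L,x_U]$ there is a design $\xi_2\in\mathcal C_0$ such that $M(\xi_2)-M(\xi_1)$ is nonnegative definite. 2. Let $c=p_1/\{(p_1+p_2-1)(1-p_0)^{x_L}\}$, $\delta=(1-p_1)/p_1$, $r=(1-p_0)^{x_U-x_L}$ and $$\Psi_0=1,\quad \Psi_1(a)=\frac{c-a}{\delta c+a},\quad \Psi_2(a)=\frac{\delta c+a}{c-a},\quad \Psi_3(a)=\frac{a\log a}{\delta c+a},\quad \Psi_4(a)=\frac{a\log a}{c-a},\quad \Psi_5(a)=\frac{(a\log a)^2}{(c-a)(\delta c+a)}.$$ There are signs $s_0,\dots,s_5\in\{1,-1\}$ such that $\{s_i\Psi_i\}_{i=0}^5$ is a Chebyshev system on $[r,1]$; that is, these functions are continuous on $[r,1]$ and $\det\bigl(s_i\Psi_i(t_j)\bigr)_{i,j=0}^5>0$ for all $r\le t_0<t_1<\dots<t_5\le 1$. -/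

import Mathlib

noncomputable section

namespace GroupTesting

/-- The probability of a positive response for a trial with (real) group size `x`, when the
prevalence, sensitivity and specificity are `p₀`, `p₁`, `p₂`. -/
def posProb (p₀ p₁ p₂ x : ℝ) : ℝ :=
  p₁ * (1 - (1 - p₀) ^ x) + (1 - p₂) * (1 - p₀) ^ x

/-- The gradient of `posProb` with respect to the parameter vector `(p₀, p₁, p₂)`
(see `hasDerivAt_posProb_prevalence`, `hasDerivAt_posProb_sensitivity` and
`hasDerivAt_posProb_specificity`). -/
def grad (p₀ p₁ p₂ x : ℝ) : Fin 3 → ℝ :=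
  ![x * (p₁ + p₂ - 1) * (1 - p₀) ^ (x - 1), 1 - (1 - p₀) ^ x, -(1 - p₀) ^ x]

theorem hasDerivAt_posProb_prevalence {p₀ : ℝ} (h : p₀ < 1) (p₁ p₂ x : ℝ) :
    HasDerivAt (fun p => posProb p p₁ p₂ x) (grad p₀ p₁ p₂ x 0) p₀ := by
  have h1 : HasDerivAt (fun p : ℝ => 1 - p) (-1) p₀ := by
    simpa using (hasDerivAt_id p₀).const_sub 1
  have h2 := h1.rpow_const (p := x) (Or.inl (by linarith : (1 - p₀) ≠ 0))
  have h3 := ((h2.const_sub 1).const_mul p₁).add (h2.const_mul (1 - p₂))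
  refine h3.congr_deriv ?_
  simp only [grad, Matrix.cons_val_zero]
  ring

theorem hasDerivAt_posProb_sensitivity (p₀ p₁ p₂ x : ℝ) :
    HasDerivAt (fun p => posProb p₀ p p₂ x) (grad p₀ p₁ p₂ x 1) p₁ := by
  have h := ((hasDerivAt_id p₁).mul_const (1 - (1 - p₀) ^ x)).add_const ((1 - p₂) * (1 - p₀) ^ x)
  refine h.congr_deriv ?_
  simp [grad]

theorem hasDerivAt_posProb_specificity (p₀ p₁ p₂ x : ℝ) :
    HasDerivAt (fun p => posProb p₀ p₁ p x) (grad p₀ p₁ p₂ x 2) p₂ := by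
  have h := (((hasDerivAt_id p₂).const_sub 1).mul_const ((1 - p₀) ^ x)).const_add
    (p₁ * (1 - (1 - p₀) ^ x))
  refine h.congr_deriv ?_
  simp [grad]

/-- The reciprocal of the variance of a single response at group size `x`. -/
def efficiency (p₀ p₁ p₂ x : ℝ) : ℝ :=
  (posProb p₀ p₁ p₂ x * (1 - posProb p₀ p₁ p₂ x))⁻¹

/-- An approximate design on `[xL, xU]`: a probability measure with finite support, given by
its weight function. The elements of `weight.support` are the support points; their
weights are positive. -/
structure Design (xL xU : ℝ) where
  weight : ℝ →₀ ℝ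
  weight_nonneg : ∀ x, 0 ≤ weight x
  weight_sum : ∑ x ∈ weight.support, weight x = 1
  support_subset : ∀ x ∈ weight.support, x ∈ Set.Icc xL xU

/-- The Fisher information matrix of a design, at the parameter vector `(p₀, p₁, p₂)`. -/
def infoMatrix (p₀ p₁ p₂ : ℝ) {xL xU : ℝ} (ξ : Design xL xU) : Matrix (Fin 3) (Fin 3) ℝ :=
  ∑ x ∈ ξ.weight.support, (ξ.weight x * efficiency p₀ p₁ p₂ x) •
    Matrix.vecMulVec (grad p₀ p₁ p₂ x) (grad p₀ p₁ p₂ x)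

/-- The designs `{(x₁, w₁), (x₂, w₂), (x₃, w₃)}` with `xL = x₁ < x₂ < x₃ ≤ xU` and nonnegative
weights that sum to one. A point of weight zero does not belong to the support of the design. -/
def classC₀ (xL xU : ℝ) : Set (Design xL xU) :=
  {ξ | ∃ x w : Fin 3 → ℝ, xL = x 0 ∧ x 0 < x 1 ∧ x 1 < x 2 ∧ x 2 ≤ xU ∧
    (∀ i, 0 ≤ w i) ∧ ∑ i, w i = 1 ∧ ξ.weight = ∑ i, Finsupp.single (x i) (w i)}

/-- A class of designs is essentially complete if the information matrix of every design is
dominated, in the Loewner order, by that of a design in the class. (For a design of the class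
there is nothing to show.) -/
def IsEssentiallyComplete (p₀ p₁ p₂ : ℝ) {xL xU : ℝ} (C : Set (Design xL xU)) : Prop :=
  ∀ ξ₁ : Design xL xU, ∃ ξ₂ ∈ C,
    (infoMatrix p₀ p₁ p₂ ξ₂ - infoMatrix p₀ p₁ p₂ ξ₁).PosSemidef

/-- A Chebyshev system on `S`: continuous functions `u 0, …, u (n - 1)` on `S` with
`det (u i (t j)) > 0` for all points `t 0 < ⋯ < t (n - 1)` of `S`. -/
def IsChebyshevSystem {n : ℕ} (u : Fin n → ℝ → ℝ) (S : Set ℝ) : Prop :=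
  (∀ i, ContinuousOn (u i) S) ∧
    ∀ t : Fin n → ℝ, StrictMono t → (∀ j, t j ∈ S) →
      0 < (Matrix.of fun i j => u i (t j)).det

/-- The constant `c`. -/
def cConst (p₀ p₁ p₂ xL : ℝ) : ℝ := p₁ / ((p₁ + p₂ - 1) * (1 - p₀) ^ xL)

/-- The constant `δ`. -/
def deltaConst (p₁ : ℝ) : ℝ := (1 - p₁) / p₁

/-- The constant `r`. -/
def rConst (p₀ xL xU : ℝ) : ℝ := (1 - p₀) ^ (xU - xL)

/-- The functions `Ψ₀, …, Ψ₅`. -/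
def Psi (c δ : ℝ) (i : Fin 6) (a : ℝ) : ℝ :=
  ![1,
    (c - a) / (δ * c + a),
    (δ * c + a) / (c - a),
    a * Real.log a / (δ * c + a),
    a * Real.log a / (c - a),
    (a * Real.log a) ^ 2 / ((c - a) * (δ * c + a))] i

end GroupTesting

end

/-! Put a = (1 - p₀) ^ (x - xL) and y = log a. Then π and 1 - π are proportional to c - a and δc +
a, and the gradient paired with a vector v is A + B a + C y a. Hence the quadratic form of the
information matrix at v is a constant plus a combination of five moments of the design along
`momentCurve`, and the coefficient of the fifth moment is nonnegative because it comes from C². It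
therefore suffices to keep four moments and not decrease the fifth
(`exists_upper_principal_representation`).

To do so, take a point with maximal fifth coordinate, the other four being fixed, in the convex hull
of the curve. A supporting functional there has nonnegative last coefficient, and only parameters
where it attains its maximum on the curve can carry mass. After multiplication by the denominator,
these are zeros of an exponential polynomial that is nonpositive on the interval, so interior ones
are double. Counting zeros leaves at most two besides y = 0, that is, besides x = xL.

The Chebyshev property rests on the same count: a vanishing determinant would give a nonzero
exponential polynomial with six zeros, while at most five are possible (`card_zeros_expPoly_le`).
The determinant then has constant sign by connectedness. -/

/-! ### Zeros of exponential polynomials -/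

/-- Rolle's theorem for finite sets of zeros, some of which are double. -/
theorem exists_finset_zeros_deriv {f f' : ℝ → ℝ} (hf : ∀ x, HasDerivAt f (f' x) x)
    {S T : Finset ℝ} (hTS : T ⊆ S) (hS : ∀ x ∈ S, f x = 0) (hT : ∀ x ∈ T, f' x = 0) :
    ∃ R : Finset ℝ, (∀ x ∈ R, f' x = 0) ∧ S.card + T.card ≤ R.card + 1 := by
  -- Disjointness from S allows the double zeros to be added to the Rolle points afterwards. The
  -- bound by a point of S keeps each new Rolle point, which lies beyond the old maximum, distinct
  -- from the earlier ones.
  have key : ∀ S : Finset ℝ, (∀ x ∈ S, f x = 0) →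
      ∃ R : Finset ℝ, (∀ x ∈ R, f' x = 0) ∧ Disjoint R S ∧ (∀ x ∈ R, ∃ y ∈ S, x < y) ∧
        S.card ≤ R.card + 1 := by
    intro S
    induction S using Finset.induction_on_max with
    | empty => exact fun _ => ⟨∅, by simp⟩
    | insert a S ha ih =>
      intro h
      rcases S.eq_empty_or_nonempty with rfl | hne
      · exact ⟨∅, by simp⟩
      obtain ⟨R, hR, hd, hlt, hcard⟩ := ih fun x hx => h x (Finset.mem_insert_of_mem hx)
      set m := S.max' hne with hm
      have hmS : m ∈ S := S.max'_mem hne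
      have hmax : ∀ y ∈ S, y ≤ m := fun y hy => S.le_max' y hy
      obtain ⟨c, hc, hc0⟩ := exists_hasDerivAt_eq_zero (ha m hmS)
        (fun x _ => (hf x).continuousAt.continuousWithinAt)
        ((h m (Finset.mem_insert_of_mem hmS)).trans (h a (Finset.mem_insert_self a S)).symm)
        (fun x _ => hf x)
      have hRm : ∀ x ∈ R, x < m := fun x hx => by
        obtain ⟨y, hy, hxy⟩ := hlt x hx
        exact hxy.trans_le (hmax y hy)
      have hcR : c ∉ R := fun h => absurd (hRm c h) (not_lt.2 hc.1.le)
      have haS : a ∉ S := fun h => lt_irrefl a (ha a h)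
      refine ⟨insert c R, ?_, ?_, ?_, ?_⟩
      · intro x hx
        rcases Finset.mem_insert.1 hx with rfl | hx
        exacts [hc0, hR x hx]
      · rw [Finset.disjoint_left] at hd ⊢
        intro x hx hxS
        rcases Finset.mem_insert.1 hx with rfl | hx <;> rcases Finset.mem_insert.1 hxS with rfl | hxS
        · exact lt_irrefl _ hc.2
        · exact absurd (hmax _ hxS) (not_le.2 hc.1)
        · exact lt_asymm (hRm _ hx) (ha m hmS)
        · exact hd hx hxS
      · intro x hx
        rcases Finset.mem_insert.1 hx with rfl | hx
        · exact ⟨a, Finset.mem_insert_self _ _, hc.2⟩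
        · exact ⟨a, Finset.mem_insert_self _ _, (hRm x hx).trans (ha m hmS)⟩
      · rw [Finset.card_insert_of_notMem hcR, Finset.card_insert_of_notMem haS]
        omega
  obtain ⟨R, hR, hd, -, hcard⟩ := key S hS
  refine ⟨R ∪ T, fun x hx => (Finset.mem_union.1 hx).elim (hR x) (hT x), ?_⟩
  rw [Finset.card_union_of_disjoint (hd.mono_right hTS)]
  omega

open Polynomial in
theorem Polynomial.card_zeros_le_natDegree {Q : ℝ[X]} (hQ : Q ≠ 0) {S : Finset ℝ}
    (hS : ∀ y ∈ S, Q.eval y = 0) : S.card ≤ Q.natDegree := by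
  refine Polynomial.card_le_degree_of_subset_roots (p := Q) fun y hy => ?_
  rw [Polynomial.mem_roots hQ]
  exact hS y hy

-- Each differentiation costs at most one zero by Rolle and lowers A, while Q becomes Q + Q', of the
-- same degree. After k of them only a polynomial times the exponential is left.
open Polynomial in
theorem card_zeros_add_mul_exp_le {k : ℕ} {A Q : ℝ[X]} (hA : derivative^[k] A = 0) (hQ : Q ≠ 0)
    {S : Finset ℝ} (hS : ∀ y ∈ S, A.eval y + Q.eval y * Real.exp y = 0) :
    S.card ≤ k + Q.natDegree := by
  induction k generalizing A Q S with
  | zero =>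
    have hA' : A = 0 := hA
    rw [zero_add]
    refine Polynomial.card_zeros_le_natDegree hQ fun y hy => ?_
    simpa [hA', Real.exp_ne_zero] using hS y hy
  | succ k ih =>
    have hdeg := degree_derivative_lt hQ
    have hQ' : Q + derivative Q ≠ 0 := fun h => by
      have := degree_add_eq_left_of_degree_lt hdeg
      rw [h, degree_zero] at this
      exact hQ (degree_eq_bot.1 this.symm)
    have hder : ∀ y, HasDerivAt (fun y => A.eval y + Q.eval y * Real.exp y)
        ((derivative A).eval y + (Q + derivative Q).eval y * Real.exp y) y := fun y => by
      refine ((A.hasDerivAt y).add ((Q.hasDerivAt y).mul (Real.hasDerivAt_exp y))).congr_deriv ?_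
      rw [eval_add]
      ring
    obtain ⟨R, hR, hcard⟩ := exists_finset_zeros_deriv hder (Finset.empty_subset S) hS (by simp)
    have := ih (A := derivative A) hA hQ' hR
    rw [natDegree_add_eq_left_of_degree_lt hdeg] at this
    simp only [Finset.card_empty] at hcard
    omega

/-- The real exponential polynomials with exponents `0`, `1`, `2` of multiplicities `1`, `2`, `3`. -/
noncomputable def expPoly (α : Fin 6 → ℝ) (y : ℝ) : ℝ :=
  α 0 + (α 1 + α 2 * y) * Real.exp y + (α 3 + α 4 * y + α 5 * y ^ 2) * Real.exp y ^ 2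

noncomputable def expPolyDeriv (α : Fin 6 → ℝ) (y : ℝ) : ℝ :=
  (α 1 + α 2 + α 2 * y) * Real.exp y +
    (2 * α 3 + α 4 + (2 * α 4 + 2 * α 5) * y + 2 * α 5 * y ^ 2) * Real.exp y ^ 2

theorem hasDerivAt_expPoly (α : Fin 6 → ℝ) (y : ℝ) :
    HasDerivAt (expPoly α) (expPolyDeriv α y) y := by
  have he := Real.hasDerivAt_exp y
  have hy := hasDerivAt_id y
  have h := ((((hy.const_mul (α 2)).const_add (α 1)).mul he).const_add (α 0)).add
    ((((hy.const_mul (α 4)).const_add (α 3)).add ((hy.pow 2).const_mul (α 5))).mul (he.pow 2))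
  refine h.congr_deriv ?_
  simp [expPolyDeriv]
  ring

open Polynomial in
/-- A nonzero exponential polynomial has at most five zeros, counted with multiplicities up to two,
and at most four if its leading coefficient vanishes. -/
theorem card_zeros_expPoly_le {α : Fin 6 → ℝ} (hα : α ≠ 0) {d : ℕ} (hd : 1 ≤ d)
    (hd' : α 5 = 0 ∨ 2 ≤ d) {S T : Finset ℝ} (hTS : T ⊆ S)
    (hS : ∀ y ∈ S, expPoly α y = 0) (hT : ∀ y ∈ T, expPolyDeriv α y = 0) :
    S.card + T.card ≤ d + 3 := by
  obtain ⟨R, hR, hcard⟩ := exists_finset_zeros_deriv (hasDerivAt_expPoly α) hTS hS hT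
  -- The derivative has lost the constant term; dividing it by exp y leaves A + Q exp y.
  set A : ℝ[X] := C (α 1 + α 2) + C (α 2) * X with hA
  set Q : ℝ[X] := C (2 * α 3 + α 4) + C (2 * α 4 + 2 * α 5) * X + C (2 * α 5) * X ^ 2 with hQdef
  have hR' : ∀ y ∈ R, A.eval y + Q.eval y * Real.exp y = 0 := by
    intro y hy
    have h := hR y hy
    have h2 : expPolyDeriv α y = (A.eval y + Q.eval y * Real.exp y) * Real.exp y := by
      simp [hA, hQdef, expPolyDeriv]
      ring
    rw [h2] at h
    exact (mul_eq_zero.1 h).resolve_right (Real.exp_ne_zero y)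
  by_cases hQ : Q = 0
  · have h2 : α 5 = 0 := by
      simpa [hQdef, -map_mul] using congrArg (fun p => coeff p 2) hQ
    have h1 : α 4 = 0 := by simpa [hQdef, h2] using congrArg (fun p => coeff p 1) hQ
    have h0 : α 3 = 0 := by simpa [hQdef, h1] using congrArg (fun p => coeff p 0) hQ
    by_cases hA0 : A = 0
    · have h3 : α 2 = 0 := by simpa [hA] using congrArg (fun p => coeff p 1) hA0
      have h4 : α 1 = 0 := by simpa [hA, h3] using congrArg (fun p => coeff p 0) hA0
      have h5 : α 0 ≠ 0 := fun h5 => hα (by ext i; fin_cases i <;> simp [*])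
      have hSe : S = ∅ := Finset.eq_empty_of_forall_notMem fun y hy => h5 <| by
        simpa [expPoly, *] using hS y hy
      subst hSe
      rw [Finset.subset_empty.1 hTS]
      simp
    · have := Polynomial.card_zeros_le_natDegree hA0 (S := R) fun y hy => by
        simpa [hQ] using hR' y hy
      have hdeg : A.natDegree ≤ 1 := by
        rw [hA]
        compute_degree
      omega
  -- A is killed by two derivatives, so R has at most 2 + d points; the first use of Rolle adds one
  -- more.
  · have hAd : derivative^[2] A = 0 := by simp [hA]
    have := card_zeros_add_mul_exp_le hAd hQ hR'
    have hdeg : Q.natDegree ≤ d := by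
      rcases hd' with h | h
      · rw [hQdef, h]
        simp only [mul_zero, C_0, zero_mul, add_zero]
        refine le_trans ?_ hd
        compute_degree
      · rw [hQdef]
        refine le_trans ?_ h
        compute_degree
    omega

/-- With positive leading coefficient, an exponential polynomial that is nonpositive at `0`
has a nonnegative zero. -/
theorem exists_nonneg_zero_expPoly {α : Fin 6 → ℝ} (h5 : 0 < α 5) (h0 : expPoly α 0 ≤ 0) :
    ∃ z, 0 ≤ z ∧ expPoly α z = 0 := by
  set K := |α 0| + |α 1| + |α 2| + |α 3| + |α 4| with hK
  have hK0 : 0 ≤ K := by positivity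
  -- As y ≥ 1, the lower terms add up to at most K y exp(y)² in absolute value, and α 5 * y > K
  -- makes the leading term win.
  set y := 1 + K / α 5 with hy
  have hy1 : 1 ≤ y := le_add_of_nonneg_right (by positivity)
  have hyK : K < α 5 * y := by
    rw [hy, mul_add, mul_div_cancel₀ _ h5.ne']
    linarith
  have hE : 1 ≤ Real.exp y := Real.one_le_exp (by linarith)
  have hpos : 0 ≤ expPoly α y := by
    set E := Real.exp y with hEdef
    have hyE : 1 ≤ y * E ^ 2 := by nlinarith [mul_nonneg (sub_nonneg.2 hy1) (sub_nonneg.2 hE)]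
    have b0 : -(|α 0| * (y * E ^ 2)) ≤ α 0 := by
      nlinarith [neg_abs_le (α 0), abs_nonneg (α 0)]
    have b1 : -(|α 1| * (y * E ^ 2)) ≤ α 1 * E := by
      have h1 : E ≤ y * E ^ 2 := by nlinarith
      have h2 := mul_le_mul_of_nonneg_left h1 (abs_nonneg (α 1))
      have h3 := mul_le_mul_of_nonneg_right (neg_abs_le (α 1)) (zero_le_one.trans hE)
      linarith
    have b2 : -(|α 2| * (y * E ^ 2)) ≤ α 2 * y * E := by
      have h1 : y * E ≤ y * E ^ 2 := by nlinarith
      have h2 := mul_le_mul_of_nonneg_left h1 (abs_nonneg (α 2))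
      have h3 := mul_le_mul_of_nonneg_right (neg_abs_le (α 2))
        (mul_nonneg (zero_le_one.trans hy1) (zero_le_one.trans hE))
      linarith
    have b3 : -(|α 3| * (y * E ^ 2)) ≤ α 3 * E ^ 2 := by
      have h1 : E ^ 2 ≤ y * E ^ 2 := by nlinarith [sq_nonneg E]
      have h2 := mul_le_mul_of_nonneg_left h1 (abs_nonneg (α 3))
      have h3 := mul_le_mul_of_nonneg_right (neg_abs_le (α 3)) (sq_nonneg E)
      linarith
    have b4 : -(|α 4| * (y * E ^ 2)) ≤ α 4 * y * E ^ 2 := by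
      have h3 := mul_le_mul_of_nonneg_right (neg_abs_le (α 4)) (zero_le_one.trans hyE)
      linarith
    have b5 : K * (y * E ^ 2) ≤ α 5 * y * (y * E ^ 2) :=
      mul_le_mul_of_nonneg_right hyK.le (zero_le_one.trans hyE)
    have : expPoly α y = α 0 + α 1 * E + α 2 * y * E + α 3 * E ^ 2 + α 4 * y * E ^ 2 +
        α 5 * y * (y * E ^ 2) := by
      rw [expPoly]
      ring
    rw [hK] at b5
    linarith
  have hc : ContinuousOn (expPoly α) (Set.Icc 0 y) :=
    fun x _ => (hasDerivAt_expPoly α x).continuousAt.continuousWithinAt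
  obtain ⟨z, hz, hz0⟩ := intermediate_value_Icc (zero_le_one.trans hy1) hc ⟨h0, hpos⟩
  exact ⟨z, hz.1, hz0⟩

/-! ### Convex geometry in finite dimension -/

/-- By Carathéodory the hull is the continuous image of a product of copies of s with a simplex.
Shorter combinations are padded with a repeated point of weight zero. -/
theorem IsCompact.convexHull_of_finiteDimensional {E : Type*} [NormedAddCommGroup E]
    [NormedSpace ℝ E] [FiniteDimensional ℝ E] {s : Set E} (hs : IsCompact s) :
    IsCompact (convexHull ℝ s) := by
  set N := Module.finrank ℝ E + 1
  have hK : IsCompact ((Set.univ.pi fun _ : Fin N => s) ×ˢ stdSimplex ℝ (Fin N)) :=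
    (isCompact_univ_pi fun _ => hs).prod (isCompact_stdSimplex ℝ (Fin N))
  have hcont : Continuous fun p : (Fin N → E) × (Fin N → ℝ) => ∑ i, p.2 i • p.1 i := by fun_prop
  convert hK.image hcont
  ext x
  constructor
  · intro hx
    obtain ⟨ι, _, z, w, hz, hind, hw, hw1, hx⟩ := eq_pos_convex_span_of_mem_convexHull hx
    have hcard : Fintype.card ι ≤ Fintype.card (Fin N) := by
      rw [Fintype.card_fin]
      exact hind.card_le_finrank_succ.trans (Nat.succ_le_succ (Submodule.finrank_le _))
    obtain ⟨e⟩ := Function.Embedding.nonempty_of_card_le hcard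
    have hι : Nonempty ι := by
      by_contra h
      rw [not_nonempty_iff] at h
      simp at hw1
    obtain ⟨i₀⟩ := hι
    have hext : ∀ j ∉ Set.range e, Function.extend e w 0 j = 0 := fun j hj =>
      Function.extend_apply' _ _ _ hj
    refine ⟨(Function.extend e z fun _ => z i₀, Function.extend e w 0),
      ⟨fun j _ => ?_, fun j => ?_, ?_⟩, ?_⟩
    · by_cases hj : j ∈ Set.range e
      · obtain ⟨i, rfl⟩ := hj
        simpa [e.injective.extend_apply] using hz ⟨i, rfl⟩
      · have : Function.extend e z (fun _ => z i₀) j = z i₀ := Function.extend_apply' _ _ _ hj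
        simpa [this] using hz ⟨i₀, rfl⟩
    · by_cases hj : j ∈ Set.range e
      · obtain ⟨i, rfl⟩ := hj
        simpa [e.injective.extend_apply] using (hw i).le
      · exact (hext j hj).ge
    · rw [← hw1]
      exact (Fintype.sum_of_injective e e.injective _ _ hext
        fun i => (e.injective.extend_apply _ _ _).symm).symm
    · rw [← hx]
      refine (Fintype.sum_of_injective e e.injective _ _ (fun j hj => ?_) fun i => ?_).symm
      · simp only [hext j hj, zero_smul]
      · simp only [e.injective.extend_apply]
  · rintro ⟨p, ⟨hp1, hp2⟩, rfl⟩
    exact (convex_convexHull ℝ s).sum_mem (fun i _ => hp2.1 i) hp2.2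
      fun i _ => subset_convexHull ℝ s (hp1 i (Set.mem_univ i))

/-- A supporting functional at a point where a convex set is left in the direction `e`. -/
theorem Convex.exists_supporting_functional {E : Type*} [NormedAddCommGroup E] [NormedSpace ℝ E]
    [FiniteDimensional ℝ E] {K : Set E} (hK : Convex ℝ K) {q e : E} (hq : q ∈ K)
    (he : ∀ t : ℝ, 0 < t → q + t • e ∉ K) :
    ∃ l : E →L[ℝ] ℝ, l ≠ 0 ∧ 0 ≤ l e ∧ ∀ x ∈ K, l x ≤ l q := by
  by_cases hint : (interior K).Nonempty
  · set R : Set E := (fun t : ℝ => q + t • e) '' Set.Ici 0 with hR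
    have hRconv : Convex ℝ R := by
      have : R = (AffineMap.lineMap q (q + e) : ℝ →ᵃ[ℝ] E) '' Set.Ici 0 := by
        rw [hR]
        congr 1
        ext t
        simp [AffineMap.lineMap_apply, add_comm]
      rw [this]
      exact (convex_Ici 0).affine_image _
    -- An interior point on the ray could be pushed slightly further along e inside K; this covers t
    -- = 0 too.
    have hdisj : Disjoint (interior K) R := by
      rw [Set.disjoint_left]
      rintro _ hx ⟨t, ht, rfl⟩
      have hc : Continuous fun u : ℝ => q + u • e := by fun_prop
      have hmem := (hc.continuousAt (x := t)).preimage_mem_nhds (isOpen_interior.mem_nhds hx)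
      obtain ⟨u, hu, hut⟩ := ((frequently_gt_nhds t).and_eventually hmem).exists
      exact he u (lt_of_le_of_lt ht hu) (interior_subset hut)
    obtain ⟨l, u, hl, hu⟩ := geometric_hahn_banach_open hK.interior isOpen_interior hRconv hdisj
    have hray : ∀ t : ℝ, 0 ≤ t → u ≤ l q + t * l e := fun t ht => by
      simpa using hu _ ⟨t, ht, rfl⟩
    have hKu : ∀ x ∈ K, l x ≤ u := by
      intro x hx
      have hx' : x ∈ closure (interior K) := by
        rw [hK.closure_interior_eq_closure_of_nonempty_interior hint]
        exact subset_closure hx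
      exact closure_minimal (fun a ha => (hl a ha).le)
        (isClosed_le l.continuous continuous_const) hx'
    have hqu : u ≤ l q := by simpa using hray 0 le_rfl
    refine ⟨l, ?_, ?_, fun x hx => (hKu x hx).trans hqu⟩
    · rintro rfl
      obtain ⟨x, hx⟩ := hint
      have := hl x hx
      simp at this hqu
      linarith
    · by_contra h
      push Not at h
      have h1 := hKu q hq
      have h2 := hray 1 zero_le_one
      linarith
  -- With empty interior, K lies in a hyperplane; its functional is constant on K, so its sign is
  -- free to be fitted to e.
  · rw [hK.interior_nonempty_iff_affineSpan_eq_top,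
      ← AffineSubspace.direction_eq_top_iff_of_nonempty ⟨q, mem_affineSpan ℝ hq⟩] at hint
    obtain ⟨f, hf, hker⟩ := Submodule.exists_le_ker_of_lt_top _ (lt_top_iff_ne_top.2 hint)
    have hconst : ∀ x ∈ K, f x = f q := fun x hx => by
      have := hker (AffineSubspace.vsub_mem_direction (mem_affineSpan ℝ hx) (mem_affineSpan ℝ hq))
      rwa [LinearMap.mem_ker, vsub_eq_sub, map_sub, sub_eq_zero] at this
    set g := LinearMap.toContinuousLinearMap f with hg
    have hg0 : g ≠ 0 := fun h => hf (LinearMap.toContinuousLinearMap.map_eq_zero_iff.1 h)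
    rcases le_total 0 (g e) with h | h
    · exact ⟨g, hg0, h, fun x hx => (hconst x hx).le⟩
    · refine ⟨-g, neg_ne_zero.2 hg0, by simpa using h, fun x hx => ?_⟩
      simpa [hg] using (hconst x hx).ge

/-! ### The Chebyshev system -/

namespace GroupTesting

/-- A linear combination of the functions `Ψ i`, multiplied by their common denominator and written
in the variable `log a`, is an exponential polynomial. -/
theorem sum_mul_Psi_eq {c δ y : ℝ} (h1 : c - Real.exp y ≠ 0) (h2 : δ * c + Real.exp y ≠ 0)
    (β : Fin 6 → ℝ) :
    (∑ i, β i * Psi c δ i (Real.exp y)) * ((c - Real.exp y) * (δ * c + Real.exp y)) =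
      expPoly ![β 0 * δ * c ^ 2 + β 1 * c ^ 2 + β 2 * δ ^ 2 * c ^ 2,
        β 0 * (1 - δ) * c - 2 * β 1 * c + 2 * β 2 * δ * c, c * β 3 + δ * c * β 4,
        -β 0 + β 1 + β 2, -β 3 + β 4, β 5] y := by
  simp only [Fin.sum_univ_six, Psi, expPoly, Real.log_exp, Matrix.cons_val_zero,
    Matrix.cons_val_one, Matrix.cons_val]
  rw [mul_comm δ c] at h2 ⊢
  field_simp
  ring

theorem det_Psi_ne_zero {c δ : ℝ} (hc : 1 < c) (hδ : 0 ≤ δ) {t : Fin 6 → ℝ} (ht : StrictMono t)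
    (ht0 : ∀ j, 0 < t j) (ht1 : ∀ j, t j ≤ 1) :
    (Matrix.of fun i j => Psi c δ i (t j)).det ≠ 0 := by
  intro hdet
  obtain ⟨β, hβ, hβ0⟩ := Matrix.exists_vecMul_eq_zero_iff.2 hdet
  set α : Fin 6 → ℝ := ![β 0 * δ * c ^ 2 + β 1 * c ^ 2 + β 2 * δ ^ 2 * c ^ 2,
        β 0 * (1 - δ) * c - 2 * β 1 * c + 2 * β 2 * δ * c, c * β 3 + δ * c * β 4,
        -β 0 + β 1 + β 2, -β 3 + β 4, β 5] with hα
  -- The passage from β to α is injective because c and -δc, the zeros of the two denominators,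
  -- differ.
  have hα0 : α ≠ 0 := by
    intro h
    have e0 : β 0 * δ * c ^ 2 + β 1 * c ^ 2 + β 2 * δ ^ 2 * c ^ 2 = 0 := congrFun h 0
    have e1 : β 0 * (1 - δ) * c - 2 * β 1 * c + 2 * β 2 * δ * c = 0 := congrFun h 1
    have e2 : c * β 3 + δ * c * β 4 = 0 := congrFun h 2
    have e3 : -β 0 + β 1 + β 2 = 0 := congrFun h 3
    have e4 : -β 3 + β 4 = 0 := congrFun h 4
    have e5 : β 5 = 0 := congrFun h 5
    have hpos : c * (1 + δ) ≠ 0 := by positivity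
    have f4 : β 4 = 0 := (mul_eq_zero.1 (show c * (1 + δ) * β 4 = 0 by
      linear_combination e2 + c * e4)).resolve_left hpos
    have f3 : β 3 = 0 := by linarith
    have f21 : β 2 - β 1 = 0 := (mul_eq_zero.1 (show c * (1 + δ) * (β 2 - β 1) = 0 by
      linear_combination e1 + (1 - δ) * c * e3)).resolve_left hpos
    have f1 : β 1 = 0 := (mul_eq_zero.1 (show (c * (1 + δ)) ^ 2 * β 1 = 0 by
      linear_combination e0 + δ * c ^ 2 * e3 - (δ * c ^ 2 + δ ^ 2 * c ^ 2) * f21)).resolve_left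
        (pow_ne_zero 2 hpos)
    have f2 : β 2 = 0 := by linarith
    have f0 : β 0 = 0 := by linarith
    exact hβ (by ext i; fin_cases i <;> assumption)
  have hcard := card_zeros_expPoly_le hα0 (d := 2) one_le_two (Or.inr le_rfl)
    (S := Finset.univ.image fun j => Real.log (t j)) (T := ∅) (Finset.empty_subset _) (by
      intro y hy
      obtain ⟨j, -, rfl⟩ := Finset.mem_image.1 hy
      have h0 := ht0 j
      have h1 := ht1 j
      rw [hα, ← sum_mul_Psi_eq (by rw [Real.exp_log h0]; linarith)
        (by rw [Real.exp_log h0]; positivity), Real.exp_log h0]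
      have := congrFun hβ0 j
      simp only [Matrix.vecMul, dotProduct, Matrix.of_apply, Pi.zero_apply] at this
      rw [this, zero_mul]) (by simp)
  rw [Finset.card_image_of_injective _ fun i j hij =>
    ht.injective (Real.log_injOn_pos (ht0 i) (ht0 j) hij)] at hcard
  simp at hcard

theorem continuousOn_Psi {c δ r : ℝ} (hc : 1 < c) (hδ : 0 ≤ δ) (hr : 0 < r) (i : Fin 6) :
    ContinuousOn (Psi c δ i) (Set.Icc r 1) := by
  have h1 : ∀ a ∈ Set.Icc r 1, c - a ≠ 0 := fun a ha => by linarith [ha.2]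
  have h2 : ∀ a ∈ Set.Icc r 1, δ * c + a ≠ 0 := fun a ha => by
    have := hr.trans_le ha.1
    positivity
  have h3 : ∀ a ∈ Set.Icc r 1, a ≠ 0 := fun a ha => (hr.trans_le ha.1).ne'
  have h4 : ∀ a ∈ Set.Icc r 1, (c - a) * (δ * c + a) ≠ 0 := fun a ha =>
    mul_ne_zero (h1 a ha) (h2 a ha)
  unfold Psi
  fin_cases i <;> simp <;> fun_prop (disch := assumption)

/-- A system of continuous functions on a convex set whose determinants never vanish is a
Chebyshev system after a change of the sign of one function. -/
theorem exists_sign_isChebyshevSystem {n : ℕ} {u : Fin (n + 1) → ℝ → ℝ} {S : Set ℝ}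
    (hS : Convex ℝ S) (hu : ∀ i, ContinuousOn (u i) S)
    (hdet : ∀ t : Fin (n + 1) → ℝ, StrictMono t → (∀ j, t j ∈ S) →
      (Matrix.of fun i j => u i (t j)).det ≠ 0) :
    ∃ s : Fin (n + 1) → ℝ, (∀ i, s i = 1 ∨ s i = -1) ∧
      IsChebyshevSystem (fun i a => s i * u i a) S := by
  set T : Set (Fin (n + 1) → ℝ) := {t | StrictMono t ∧ ∀ j, t j ∈ S} with hT
  -- Convexity makes the ordered tuples connected, so the nonvanishing determinant keeps one sign;
  -- negating one row corrects it if needed.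
  have hTconv : Convex ℝ T := by
    intro t ht t' ht' a b ha hb hab
    refine ⟨fun i j hij => ?_, fun j => hS (ht.2 j) (ht'.2 j) ha hb hab⟩
    have h1 := ht.1 hij
    have h2 := ht'.1 hij
    simp only [Pi.add_apply, Pi.smul_apply, smul_eq_mul]
    rcases ha.eq_or_lt with rfl | ha
    · rw [zero_add] at hab
      simpa [hab] using h2
    · nlinarith [mul_lt_mul_of_pos_left h1 ha, mul_le_mul_of_nonneg_left h2.le hb]
  set D : (Fin (n + 1) → ℝ) → ℝ := fun t => (Matrix.of fun i j => u i (t j)).det with hD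
  have hDc : ContinuousOn D T := by
    rw [continuousOn_iff_continuous_domRestrict]
    refine Continuous.matrix_det (continuous_matrix fun i j => ?_)
    exact continuousOn_iff_continuous_domRestrict.1
      ((hu i).comp (t := S) (s := T) (f := fun t : Fin (n + 1) → ℝ => t j)
        (continuous_apply j).continuousOn fun t ht => ht.2 j)
  have hsign : (∀ t ∈ T, 0 < D t) ∨ ∀ t ∈ T, D t < 0 := by
    by_contra! h
    obtain ⟨⟨t, ht, h1⟩, t', ht', h2⟩ := h
    obtain ⟨z, hz, hz0⟩ := hTconv.isPreconnected.intermediate_value ht ht' hDc ⟨h1, h2⟩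
    exact hdet z hz.1 hz.2 hz0
  have hs : ∀ s : Fin (n + 1) → ℝ, (∀ t ∈ T, 0 < (∏ i, s i) * D t) →
      IsChebyshevSystem (fun i a => s i * u i a) S := by
    refine fun s h => ⟨fun i => continuousOn_const.mul (hu i), fun t ht htS => ?_⟩
    have := Matrix.det_mul_column s (Matrix.of fun i j => u i (t j))
    simp only [Matrix.of_apply] at this
    rw [this]
    exact h t ⟨ht, htS⟩
  rcases hsign with h | h
  · exact ⟨fun _ => 1, fun _ => Or.inl rfl, hs _ fun t ht => by simpa using h t ht⟩
  · refine ⟨fun i => if i = 0 then -1 else 1, fun i => ?_, hs _ fun t ht => ?_⟩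
    · by_cases hi : i = 0 <;> simp [hi]
    · simpa using h t ht

/-! ### Upper principal representation -/

/-- The curve in `ℝ⁵` whose moments, together with the total mass, determine the information
matrix; `y` is the logarithm of the variable of the functions `Ψ i`. -/
noncomputable def momentCurve (c δ y : ℝ) : Fin 5 → ℝ :=
  ((c - Real.exp y) * (δ * c + Real.exp y))⁻¹ •
    ![1, Real.exp y, y * Real.exp y, y * Real.exp y ^ 2, y ^ 2 * Real.exp y ^ 2]

theorem continuousOn_momentCurve {c δ L : ℝ} (hc : 1 < c) (hδ : 0 ≤ δ) :
    ContinuousOn (momentCurve c δ) (Set.Icc L 0) := by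
  have hden : ∀ y ∈ Set.Icc L 0, (c - Real.exp y) * (δ * c + Real.exp y) ≠ 0 := fun y hy => by
    have := Real.exp_le_one_iff.2 hy.2
    exact mul_ne_zero (by linarith) (by positivity)
  have hinv : ContinuousOn (fun y => ((c - Real.exp y) * (δ * c + Real.exp y))⁻¹) (Set.Icc L 0) :=
    ContinuousOn.inv₀ (by fun_prop) hden
  refine hinv.smul (continuousOn_pi.2 fun i => ?_)
  fin_cases i <;> simp <;> fun_prop

/-- Coefficients of the exponential polynomial that is the product of `∑ i, b i * γ i - v` and the
denominator of the moment curve `γ`. -/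
noncomputable def supportCoeff (c δ : ℝ) (b : Fin 5 → ℝ) (v : ℝ) : Fin 6 → ℝ :=
  ![b 0 - v * δ * c ^ 2, b 1 - v * (1 - δ) * c, b 2, v, b 3, b 4]

theorem expPoly_supportCoeff {c δ y : ℝ} (h1 : c - Real.exp y ≠ 0) (h2 : δ * c + Real.exp y ≠ 0)
    (b : Fin 5 → ℝ) (v : ℝ) :
    expPoly (supportCoeff c δ b v) y =
      ((∑ i, momentCurve c δ y i * b i) - v) *
        ((c - Real.exp y) * (δ * c + Real.exp y)) := by
  have h : ∑ i, momentCurve c δ y i * b i =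
      ((c - Real.exp y) * (δ * c + Real.exp y))⁻¹ * (b 0 + b 1 * Real.exp y +
        b 2 * (y * Real.exp y) + b 3 * (y * Real.exp y ^ 2) + b 4 * (y ^ 2 * Real.exp y ^ 2)) := by
    simp [Fin.sum_univ_five, momentCurve]
    ring
  rw [h, sub_mul, mul_comm _⁻¹, inv_mul_cancel_right₀ (mul_ne_zero h1 h2)]
  simp [expPoly, supportCoeff]
  ring

theorem supportCoeff_ne_zero {c δ : ℝ} {b : Fin 5 → ℝ} (hb : b ≠ 0) (v : ℝ) :
    supportCoeff c δ b v ≠ 0 := by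
  intro h
  have e0 : b 0 - v * δ * c ^ 2 = 0 := congrFun h 0
  have e1 : b 1 - v * (1 - δ) * c = 0 := congrFun h 1
  have e2 : b 2 = 0 := congrFun h 2
  have e3 : v = 0 := congrFun h 3
  have e4 : b 3 = 0 := congrFun h 4
  have e5 : b 4 = 0 := congrFun h 5
  simp only [e3, zero_mul, sub_zero] at e0 e1
  exact hb (by ext i; fin_cases i <;> assumption)

/-- An exponential polynomial with nonnegative leading coefficient that is nonpositive on `[L, 0]`
has at most two zeros in `[L, 0)`. -/
theorem card_erase_zeros_le_two {L : ℝ} {α : Fin 6 → ℝ} (hα : α ≠ 0) (h5 : 0 ≤ α 5) (hL : L < 0)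
    (hneg : ∀ y ∈ Set.Icc L 0, expPoly α y ≤ 0) {S : Finset ℝ} (hS : ↑S ⊆ Set.Icc L 0)
    (hS0 : ∀ y ∈ S, expPoly α y = 0) : (S.erase 0).card ≤ 2 := by
  set S' := S.erase 0
  have hS'0 : ∀ y ∈ S', expPoly α y = 0 := fun y hy => hS0 y (Finset.mem_of_mem_erase hy)
  have hS'neg : ∀ y ∈ S', y < 0 := fun y hy =>
    lt_of_le_of_ne (hS (Finset.mem_of_mem_erase hy)).2 (Finset.ne_of_mem_erase hy)
  -- Zeros inside the interval are local maxima, hence double; only L may be simple.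
  have hT : ∀ y ∈ S'.erase L, expPolyDeriv α y = 0 := by
    intro y hy
    have hyS := Finset.mem_of_mem_erase hy
    have hLy : L < y := lt_of_le_of_ne (hS (Finset.mem_of_mem_erase hyS)).1
      (Finset.ne_of_mem_erase hy).symm
    refine IsLocalMax.hasDerivAt_eq_zero ?_ (hasDerivAt_expPoly α y)
    filter_upwards [Icc_mem_nhds hLy (hS'neg y hyS)] with x hx
    rw [hS'0 y hyS]
    exact hneg x hx
  have hcard := Finset.pred_card_le_card_erase (s := S') (a := L)
  -- With n zeros in S', the count is at least 2n - 1. It is at most 4 if the leading coefficient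
  -- vanishes; otherwise an extra zero z ≥ 0 gives 2n ≤ 5.
  rcases h5.eq_or_lt with h | h
  · have := card_zeros_expPoly_le hα le_rfl (Or.inl h.symm) (Finset.erase_subset L S') hS'0 hT
    omega
  · obtain ⟨z, hz, hz0⟩ := exists_nonneg_zero_expPoly h (hneg 0 ⟨hL.le, le_rfl⟩)
    have hzS : z ∉ S' := fun hzS => absurd (hS'neg z hzS) (not_lt.2 hz)
    have := card_zeros_expPoly_le hα one_le_two (Or.inr le_rfl)
      ((Finset.erase_subset L S').trans (Finset.subset_insert z S'))
      (fun y hy => (Finset.mem_insert.1 hy).elim (fun h => h ▸ hz0) (hS'0 y)) hT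
    rw [Finset.card_insert_of_notMem hzS] at this
    omega

/-- Missing points are filled in and will carry weight zero. -/
theorem exists_pair_superset {L : ℝ} (hL : L < 0) {A : Finset ℝ} (hA : ∀ y ∈ A, L ≤ y ∧ y < 0)
    (hcard : A.card ≤ 2) : ∃ y₁ y₂, L ≤ y₂ ∧ y₂ < y₁ ∧ y₁ < 0 ∧ A ⊆ {y₁, y₂} := by
  interval_cases h : A.card
  · rw [Finset.card_eq_zero] at h
    exact ⟨L / 2, L, le_rfl, by linarith, by linarith, by simp [h]⟩
  · obtain ⟨a, rfl⟩ := Finset.card_eq_one.1 h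
    obtain ⟨h1, h2⟩ := hA a (by simp)
    rcases h1.eq_or_lt with rfl | h1
    · exact ⟨L / 2, L, le_rfl, by linarith, by linarith, by simp⟩
    · exact ⟨a, L, le_rfl, h1, h2, by simp⟩
  · obtain ⟨a, b, hab, rfl⟩ := Finset.card_eq_two.1 h
    have ha := hA a (by simp)
    have hb := hA b (by simp)
    rcases hab.lt_or_gt with h | h
    · exact ⟨b, a, ha.1, h, hb.2, by rw [Finset.pair_comm]⟩
    · exact ⟨a, b, hb.1, h, ha.2, subset_rfl⟩

/-- Collecting the masses of a weighted family of points on a set of points that carries it. -/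
theorem exists_weights_of_subset_range {ι κ X : Type*} [Fintype ι] [Fintype κ] {w : ι → ℝ}
    {z : ι → X} {y : κ → X} (hw : ∀ i, 0 ≤ w i) (hy : Function.Injective y)
    (hz : ∀ i, 0 < w i → z i ∈ Set.range y) :
    ∃ u : κ → ℝ, (∀ j, 0 ≤ u j) ∧ ∀ g : X → ℝ, ∑ j, u j * g (y j) = ∑ i, w i * g (z i) := by
  classical
  refine ⟨fun j => ∑ i, if z i = y j then w i else 0, fun j => Finset.sum_nonneg fun i _ => ?_,
    fun g => ?_⟩
  · split_ifs
    exacts [hw i, le_rfl]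
  simp only [Finset.sum_mul]
  rw [Finset.sum_comm]
  refine Finset.sum_congr rfl fun i _ => ?_
  rcases (hw i).eq_or_lt with h | h
  · simp [← h]
  · obtain ⟨j, hj⟩ := hz i h
    rw [Finset.sum_eq_single j]
    · simp [hj]
    · intro k _ hk
      rw [if_neg fun h => hk (hy (h.symm.trans hj.symm)), zero_mul]
    · simp

/-- Upper principal representation: every probability measure with finite support in `[L, 0]` has
the same first four moments as some measure on `0` and two further points, whose fifth moment is
at least as large. -/
theorem exists_upper_principal_representation {c δ L : ℝ} (hc : 1 < c) (hδ : 0 ≤ δ) (hL : L < 0)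
    {ι : Type*} [Fintype ι] {w z : ι → ℝ} (hw : ∀ i, 0 ≤ w i) (hw1 : ∑ i, w i = 1)
    (hz : ∀ i, z i ∈ Set.Icc L 0) :
    ∃ y u : Fin 3 → ℝ, y 0 = 0 ∧ y 1 < y 0 ∧ y 2 < y 1 ∧ L ≤ y 2 ∧ (∀ j, 0 ≤ u j) ∧
      ∑ j, u j = 1 ∧
      (∀ k ≠ 4, ∑ j, u j * momentCurve c δ (y j) k = ∑ i, w i * momentCurve c δ (z i) k) ∧
      ∑ i, w i * momentCurve c δ (z i) 4 ≤ ∑ j, u j * momentCurve c δ (y j) 4 := by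
  set γ := momentCurve c δ with hγ
  set K := convexHull ℝ (γ '' Set.Icc L 0) with hK
  have hKconv : Convex ℝ K := convex_convexHull ℝ _
  have hKcomp : IsCompact K :=
    (isCompact_Icc.image_of_continuousOn (continuousOn_momentCurve hc hδ)).convexHull_of_finiteDimensional
  set p := ∑ i, w i • γ (z i) with hp
  have hpK : p ∈ K := hKconv.sum_mem (fun i _ => hw i) hw1
    fun i _ => subset_convexHull ℝ _ ⟨z i, hz i, rfl⟩
  have hclosed : IsClosed {x : Fin 5 → ℝ | ∀ k ≠ 4, x k = p k} := by
    simp only [Set.ofPred_forall]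
    exact isClosed_iInter fun k => isClosed_iInter fun _ =>
      isClosed_eq (continuous_apply k) continuous_const
  obtain ⟨q, ⟨hqK, hqp⟩, hqmax⟩ := (hKcomp.inter_right hclosed).exists_isMaxOn
    ⟨p, hpK, fun _ _ => rfl⟩ (continuous_apply (4 : Fin 5)).continuousOn
  -- Moving up in the fifth coordinate would contradict the maximality of q.
  have hleave : ∀ t : ℝ, 0 < t → q + t • Pi.single (4 : Fin 5) (1 : ℝ) ∉ K := by
    intro t ht hmem
    have := hqmax (a := q + t • Pi.single (4 : Fin 5) (1 : ℝ))
      ⟨hmem, fun k hk => by simpa [Pi.single_eq_of_ne hk] using hqp k hk⟩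
    simp at this
    linarith
  obtain ⟨l, hl0, hl4, hlq⟩ := hKconv.exists_supporting_functional hqK hleave
  set b : Fin 5 → ℝ := fun i => l (Pi.single i 1) with hb
  have hlb : ∀ x, l x = ∑ i, x i * b i := fun x => by
    conv_lhs => rw [pi_eq_sum_univ' x]
    simp [hb]
  have hb0 : b ≠ 0 := fun h => hl0 <| by
    ext x
    simp [hlb, h]
  obtain ⟨ι', _, w', x', hw', hw1', hx', hsum⟩ := mem_convexHull_iff_exists_fintype.1 hqK
  choose z' hz' hzx' using hx'
  have hden : ∀ y ∈ Set.Icc L 0, 0 < c - Real.exp y ∧ 0 < δ * c + Real.exp y := by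
    intro y hy
    have := Real.exp_le_one_iff.2 hy.2
    exact ⟨by linarith, by positivity⟩
  have hF : ∀ y ∈ Set.Icc L 0, expPoly (supportCoeff c δ b (l q)) y =
      (l (γ y) - l q) * ((c - Real.exp y) * (δ * c + Real.exp y)) := fun y hy => by
    rw [hlb (γ y)]
    exact expPoly_supportCoeff (hden y hy).1.ne' (hden y hy).2.ne' b (l q)
  have hγK : ∀ y ∈ Set.Icc L 0, l (γ y) ≤ l q := fun y hy =>
    hlq _ (subset_convexHull ℝ _ ⟨y, hy, rfl⟩)
  -- An average of values at most l q equals l q only if every value of positive weight does.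
  have hzero : ∀ i, 0 < w' i → l (γ (z' i)) = l q := by
    have hs : ∑ i, w' i * (l q - l (γ (z' i))) = 0 := by
      simp only [mul_sub, Finset.sum_sub_distrib]
      rw [← Finset.sum_mul, hw1', ← hsum, map_sum]
      simp [hzx']
    rw [Finset.sum_eq_zero_iff_of_nonneg fun i _ =>
      mul_nonneg (hw' i) (sub_nonneg.2 (hγK _ (hz' i)))] at hs
    intro i hi
    have := (mul_eq_zero.1 (hs i (Finset.mem_univ i))).resolve_left hi.ne'
    linarith
  classical
  set S : Finset ℝ := (Finset.univ.filter fun i => 0 < w' i).image z' with hS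
  have hSI : ↑S ⊆ Set.Icc L 0 := by
    intro y hy
    obtain ⟨i, -, rfl⟩ := Finset.mem_image.1 (Finset.mem_coe.1 hy)
    exact hz' i
  have hcard := card_erase_zeros_le_two (supportCoeff_ne_zero (c := c) (δ := δ) hb0 (l q)) hl4 hL
    (fun y hy => by
      rw [hF y hy]
      exact mul_nonpos_of_nonpos_of_nonneg (sub_nonpos.2 (hγK y hy))
        (mul_pos (hden y hy).1 (hden y hy).2).le) hSI
    (fun y hy => by
      rw [hF y (hSI hy)]
      obtain ⟨i, hi, rfl⟩ := Finset.mem_image.1 hy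
      rw [hzero i (Finset.mem_filter.1 hi).2, sub_self, zero_mul])
  obtain ⟨y₁, y₂, h2, h12, h1, hsub⟩ := exists_pair_superset hL (A := S.erase 0)
    (fun y hy => ⟨(hSI (Finset.mem_of_mem_erase hy)).1,
      lt_of_le_of_ne (hSI (Finset.mem_of_mem_erase hy)).2 (Finset.ne_of_mem_erase hy)⟩) hcard
  have hanti : StrictAnti ![0, y₁, y₂] := by
    refine Fin.strictAnti_iff_succ_lt.2 fun i => ?_
    fin_cases i
    exacts [h1, h12]
  obtain ⟨u, hu, hug⟩ := exists_weights_of_subset_range (z := z') (y := ![0, y₁, y₂]) hw'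
    hanti.injective fun i hi => by
      by_cases h0 : z' i = 0
      · exact ⟨0, h0.symm⟩
      have hmem : z' i ∈ S.erase 0 := Finset.mem_erase.2
        ⟨h0, Finset.mem_image_of_mem _ (Finset.mem_filter.2 ⟨Finset.mem_univ i, hi⟩)⟩
      rcases Finset.mem_insert.1 (hsub hmem) with h | h
      · exact ⟨1, h.symm⟩
      · exact ⟨2, (Finset.mem_singleton.1 h).symm⟩
  have hq : ∀ k, ∑ j, u j * γ (![0, y₁, y₂] j) k = q k := fun k => by
    rw [hug fun y => γ y k, ← hsum]
    simp [hzx']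
  have hpk : ∀ k, p k = ∑ i, w i * γ (z i) k := fun k => by simp [hp]
  refine ⟨![0, y₁, y₂], u, rfl, h1, h12, h2, hu, ?_, fun k hk => ?_, ?_⟩
  · simpa [hw1'] using hug fun _ => 1
  · rw [hq, ← hpk, hqp k hk]
  · rw [hq, ← hpk]
    exact hqmax ⟨hpK, fun _ _ => rfl⟩

/-! ### From designs to moments -/

theorem one_lt_cConst {p₀ p₁ p₂ xL : ℝ} (hp₀ : 0 < p₀ ∧ p₀ < 1) (hp₁ : 1 / 2 < p₁)
    (hp₂ : 1 / 2 < p₂ ∧ p₂ ≤ 1) (hxL : 0 < xL) : 1 < cConst p₀ p₁ p₂ xL := by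
  have hq : 0 < 1 - p₀ := by linarith [hp₀.2]
  have hQ := Real.rpow_pos_of_pos hq xL
  have hQ1 := Real.rpow_lt_one hq.le (by linarith [hp₀.1]) hxL
  have hk : 0 < p₁ + p₂ - 1 := by linarith [hp₂.1]
  rw [cConst, one_lt_div (mul_pos hk hQ)]
  nlinarith [hp₂.2]

theorem deltaConst_nonneg {p₁ : ℝ} (hp₁ : 1 / 2 < p₁ ∧ p₁ ≤ 1) : 0 ≤ deltaConst p₁ :=
  div_nonneg (by linarith [hp₁.2]) (by linarith [hp₁.1])

open Matrix

theorem efficiency_mul_sq_eq {p₀ p₁ p₂ xL : ℝ} (hp₀ : 0 < p₀ ∧ p₀ < 1)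
    (hp₁ : 1 / 2 < p₁ ∧ p₁ ≤ 1) (hp₂ : 1 / 2 < p₂ ∧ p₂ ≤ 1) (hxL : 1 ≤ xL) (v : Fin 3 → ℝ) :
    ∃ (e : ℝ) (b : Fin 5 → ℝ), 0 ≤ b 4 ∧ ∀ x, xL ≤ x →
      efficiency p₀ p₁ p₂ x * (grad p₀ p₁ p₂ x ⬝ᵥ v) ^ 2 =
        e + ∑ i, b i * momentCurve (cConst p₀ p₁ p₂ xL) (deltaConst p₁)
          ((x - xL) * Real.log (1 - p₀)) i := by
  obtain ⟨hp₀, hp₀'⟩ := hp₀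
  obtain ⟨hp₁, hp₁'⟩ := hp₁
  obtain ⟨hp₂, hp₂'⟩ := hp₂
  have hq : 0 < 1 - p₀ := by linarith
  have hlog : Real.log (1 - p₀) ≠ 0 := (Real.log_neg hq (by linarith)).ne
  have hk : 0 < p₁ + p₂ - 1 := by linarith
  have hδ : 0 ≤ deltaConst p₁ := deltaConst_nonneg ⟨hp₁, hp₁'⟩
  have hc : 1 < cConst p₀ p₁ p₂ xL := one_lt_cConst ⟨hp₀, hp₀'⟩ hp₁ ⟨hp₂, hp₂'⟩ (by linarith)
  have hQ : 0 < (1 - p₀) ^ xL := Real.rpow_pos_of_pos hq xL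
  have hkc : (p₁ + p₂ - 1) * (1 - p₀) ^ xL * cConst p₀ p₁ p₂ xL = p₁ :=
    mul_div_cancel₀ _ (mul_pos hk hQ).ne'
  have hδp : p₁ * deltaConst p₁ = 1 - p₁ := mul_div_cancel₀ _ (by linarith)
  set c := cConst p₀ p₁ p₂ xL
  set δ := deltaConst p₁
  set k := p₁ + p₂ - 1 with hkdef
  set Q := (1 - p₀) ^ xL with hQdef
  set A := v 1
  set B := v 0 * xL * k * Q / (1 - p₀) - v 1 * Q - v 2 * Q with hB
  set C := v 0 * k * Q / (Real.log (1 - p₀) * (1 - p₀)) with hC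
  set m := ((k * Q) ^ 2)⁻¹ with hm
  -- The square of A + B a + C y a contains B² a², and a² is not a numerator of the curve. It is
  -- replaced by δc² + (1 - δ)c a - (c - a)(δc + a), whose last term gives the constant.
  refine ⟨-(m * B ^ 2), ![m * (A ^ 2 + B ^ 2 * δ * c ^ 2), m * (2 * A * B + B ^ 2 * (1 - δ) * c),
    m * (2 * A * C), m * (2 * B * C), m * C ^ 2], mul_nonneg (by positivity) (sq_nonneg C),
    fun x hx => ?_⟩
  set y := (x - xL) * Real.log (1 - p₀) with hy
  have hE : (1 - p₀) ^ x = Q * Real.exp y := by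
    rw [hQdef, hy, mul_comm (x - xL), ← Real.rpow_def_of_pos hq, ← Real.rpow_add hq]
    congr 1
    ring
  have hE1 : Real.exp y ≤ 1 := Real.exp_le_one_iff.2 <|
    mul_nonpos_of_nonneg_of_nonpos (sub_nonneg.2 hx) (Real.log_neg hq (by linarith)).le
  have hxy : x = xL + y / Real.log (1 - p₀) := by
    rw [hy, mul_div_cancel_right₀ _ hlog]
    ring
  have hden : (c - Real.exp y) * (δ * c + Real.exp y) ≠ 0 :=
    mul_ne_zero (by linarith) (by positivity)
  have heff : efficiency p₀ p₁ p₂ x = m * ((c - Real.exp y) * (δ * c + Real.exp y))⁻¹ := by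
    have h1 : posProb p₀ p₁ p₂ x = k * Q * (c - Real.exp y) := by
      rw [posProb, hE, hkdef]
      rw [hkdef] at hkc
      linear_combination -hkc
    have h2 : 1 - posProb p₀ p₁ p₂ x = k * Q * (δ * c + Real.exp y) := by
      rw [h1]
      linear_combination -hδp - (1 + δ) * hkc
    rw [efficiency, h2, h1, hm, ← mul_inv]
    congr 1
    ring
  have hgrad : grad p₀ p₁ p₂ x ⬝ᵥ v = A + B * Real.exp y + C * (y * Real.exp y) := by
    have h3 : (1 - p₀) ^ (x - 1) = Q * Real.exp y / (1 - p₀) := by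
      rw [Real.rpow_sub_one hq.ne', hE]
    have h4 : x * k * (Q * Real.exp y / (1 - p₀)) * v 0 =
        v 0 * xL * k * Q / (1 - p₀) * Real.exp y + C * (y * Real.exp y) := by
      rw [hC, hxy]
      field_simp
    simp only [dotProduct, Fin.sum_univ_three, grad, cons_val_zero, cons_val_one, cons_val]
    rw [h3, hE, ← hkdef, h4, hB]
    ring
  have hinv := inv_mul_cancel₀ hden
  rw [heff, hgrad]
  simp only [momentCurve, Fin.sum_univ_five, cons_val_zero, cons_val_one, cons_val, Pi.smul_apply,
    smul_eq_mul]
  generalize ((c - Real.exp y) * (δ * c + Real.exp y))⁻¹ = u at hinv ⊢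
  linear_combination -(m * B ^ 2) * hinv

theorem dotProduct_infoMatrix_mulVec (p₀ p₁ p₂ : ℝ) {xL xU : ℝ} (ξ : Design xL xU)
    (v : Fin 3 → ℝ) :
    v ⬝ᵥ infoMatrix p₀ p₁ p₂ ξ *ᵥ v = ∑ x ∈ ξ.weight.support,
      ξ.weight x * (efficiency p₀ p₁ p₂ x * (grad p₀ p₁ p₂ x ⬝ᵥ v) ^ 2) := by
  rw [infoMatrix, sum_mulVec, dotProduct_sum]
  refine Finset.sum_congr rfl fun x _ => ?_
  rw [smul_mulVec, vecMulVec_mulVec, dotProduct_smul, dotProduct_smul, dotProduct_comm v]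
  simp only [smul_eq_mul, MulOpposite.smul_eq_mul_unop, MulOpposite.unop_op]
  ring

theorem isHermitian_infoMatrix (p₀ p₁ p₂ : ℝ) {xL xU : ℝ} (ξ : Design xL xU) :
    (infoMatrix p₀ p₁ p₂ ξ).IsHermitian := by
  ext i j
  simp only [infoMatrix, conjTranspose_apply, Matrix.sum_apply, Matrix.smul_apply, vecMulVec_apply, star_trivial]
  exact Finset.sum_congr rfl fun x _ => by rw [mul_comm (grad p₀ p₁ p₂ x j)]

theorem sum_support_sum_single {n : ℕ} (x u : Fin n → ℝ) (g : ℝ → ℝ) :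
    ∑ a ∈ (∑ j, Finsupp.single (x j) (u j)).support,
      (∑ j, Finsupp.single (x j) (u j) : ℝ →₀ ℝ) a * g a = ∑ j, u j * g (x j) := by
  have h := Finsupp.linearCombination_apply ℝ (v := g) (∑ j, Finsupp.single (x j) (u j))
  rw [map_sum] at h
  simpa [Finsupp.linearCombination_single, Finsupp.sum] using h.symm

/-- The design with the given points and (possibly zero) weights. -/
noncomputable def Design.ofPoints {xL xU : ℝ} {n : ℕ} (x u : Fin n → ℝ)
    (hx : ∀ j, x j ∈ Set.Icc xL xU) (hu : ∀ j, 0 ≤ u j) (hu1 : ∑ j, u j = 1) : Design xL xU where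
  weight := ∑ j, Finsupp.single (x j) (u j)
  weight_nonneg a := by
    rw [Finsupp.finsetSum_apply]
    refine Finset.sum_nonneg fun j _ => ?_
    rw [Finsupp.single_apply]
    split_ifs
    exacts [hu j, le_rfl]
  weight_sum := by simpa [hu1] using sum_support_sum_single x u fun _ => 1
  support_subset a ha := by
    rw [Finsupp.mem_support_iff, Finsupp.finsetSum_apply] at ha
    obtain ⟨j, -, hj⟩ := Finset.exists_ne_zero_of_sum_ne_zero ha
    rw [Finsupp.single_apply] at hj
    split_ifs at hj with h
    exacts [h ▸ hx j, absurd rfl hj]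

theorem isEssentiallyComplete_classC₀ {p₀ p₁ p₂ xL xU : ℝ} (hp₀ : 0 < p₀ ∧ p₀ < 1)
    (hp₁ : 1 / 2 < p₁ ∧ p₁ ≤ 1) (hp₂ : 1 / 2 < p₂ ∧ p₂ ≤ 1) (hxL : 1 ≤ xL) (hx : xL < xU) :
    IsEssentiallyComplete p₀ p₁ p₂ (classC₀ xL xU) := by
  intro ξ
  have hc : 1 < cConst p₀ p₁ p₂ xL := one_lt_cConst hp₀ hp₁.1 hp₂ (by linarith)
  have hδ := deltaConst_nonneg hp₁
  have hlog : Real.log (1 - p₀) < 0 :=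
    Real.log_neg (by linarith [hp₀.2]) (by linarith [hp₀.1])
  set l := Real.log (1 - p₀) with hl
  obtain ⟨y, u, hy0, hy1, hy2, hyL, hu, hu1, hmom, htop⟩ := exists_upper_principal_representation
    hc hδ (L := (xU - xL) * l) (mul_neg_of_pos_of_neg (sub_pos.2 hx) hlog)
    (ι := ξ.weight.support) (w := fun a => ξ.weight a) (z := fun a => (a - xL) * l)
    (fun a => ξ.weight_nonneg a)
    ((Finset.sum_coe_sort ξ.weight.support fun a => ξ.weight a).trans ξ.weight_sum)
    (fun a => by
      have := ξ.support_subset a a.2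
      exact ⟨mul_le_mul_of_nonpos_right (by linarith [this.2]) hlog.le,
        mul_nonpos_of_nonneg_of_nonpos (sub_nonneg.2 this.1) hlog.le⟩)
  -- As l < 0, the order is reversed: y = 0 becomes xL, and the lower end of the y-interval becomes
  -- xU.
  set x : Fin 3 → ℝ := fun j => xL + y j / l with hxdef
  have hxy : ∀ j, (x j - xL) * l = y j := fun j => by
    simp only [hxdef, add_sub_cancel_left]
    exact div_mul_cancel₀ _ hlog.ne
  have hlt : ∀ i j, y i < y j → x j < x i := fun i j h =>
    (add_lt_add_iff_left xL).2 (div_lt_div_of_neg_of_lt hlog h)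
  have hx0 : x 0 = xL := by simp [hxdef, hy0]
  have h01 := hlt 1 0 hy1
  have h12 := hlt 2 1 hy2
  have hxU : x 2 ≤ xU := by
    have := (div_le_iff_of_neg hlog).2 hyL
    simp only [hxdef]
    linarith
  have hxmem : ∀ j, x j ∈ Set.Icc xL xU := by
    intro j
    fin_cases j <;> constructor <;> simp <;> linarith
  refine ⟨Design.ofPoints x u hxmem hu hu1, ⟨x, u, hx0.symm, h01, h12, hxU, hu, hu1, rfl⟩, ?_⟩
  refine PosSemidef.of_dotProduct_mulVec_nonneg
    ((isHermitian_infoMatrix _ _ _ _).sub (isHermitian_infoMatrix _ _ _ _)) fun v => ?_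
  obtain ⟨e, b, hb, hquad⟩ := efficiency_mul_sq_eq hp₀ hp₁ hp₂ hxL v
  rw [star_trivial, sub_mulVec, dotProduct_sub, dotProduct_infoMatrix_mulVec,
    dotProduct_infoMatrix_mulVec, sub_nonneg]
  set γ := momentCurve (cConst p₀ p₁ p₂ xL) (deltaConst p₁)
  have h1 : ∑ a ∈ ξ.weight.support,
      ξ.weight a * (efficiency p₀ p₁ p₂ a * (grad p₀ p₁ p₂ a ⬝ᵥ v) ^ 2) =
      e + ∑ i, b i * ∑ a : ξ.weight.support, ξ.weight a * γ ((a - xL) * l) i := by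
    have h (a : ℝ) (ha : a ∈ ξ.weight.support) := hquad a (ξ.support_subset a ha).1
    rw [Finset.sum_congr rfl fun a ha => by rw [h a ha, mul_add], Finset.sum_add_distrib,
      ← Finset.sum_mul, ξ.weight_sum, one_mul, ← Finset.sum_coe_sort]
    congr 1
    simp only [Finset.mul_sum]
    rw [Finset.sum_comm]
    exact Finset.sum_congr rfl fun i _ => Finset.sum_congr rfl fun a _ => by ring
  have h2 : ∑ a ∈ (Design.ofPoints x u hxmem hu hu1).weight.support,
      (Design.ofPoints x u hxmem hu hu1).weight a *
        (efficiency p₀ p₁ p₂ a * (grad p₀ p₁ p₂ a ⬝ᵥ v) ^ 2) =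
      e + ∑ i, b i * ∑ j, u j * γ (y j) i := by
    refine (sum_support_sum_single x u _).trans ?_
    rw [Finset.sum_congr rfl fun j _ => by rw [hquad (x j) (hxmem j).1, ← hl, hxy, mul_add],
      Finset.sum_add_distrib, ← Finset.sum_mul, hu1, one_mul]
    congr 1
    simp only [Finset.mul_sum]
    rw [Finset.sum_comm]
    exact Finset.sum_congr rfl fun i _ => Finset.sum_congr rfl fun a _ => by ring
  rw [h1, h2]
  refine add_le_add_right (Finset.sum_le_sum fun i _ => ?_) e
  by_cases hi : i = 4
  · rw [hi]
    exact mul_le_mul_of_nonneg_left htop hb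
  · rw [hmom i hi]

end GroupTesting

theorem mainTheorem3 (p₀ p₁ p₂ xL xU : ℝ) (hp₀ : 0 < p₀ ∧ p₀ < 1)
    (hp₁ : 1 / 2 < p₁ ∧ p₁ ≤ 1) (hp₂ : 1 / 2 < p₂ ∧ p₂ ≤ 1) (hxL : 1 ≤ xL) (hx : xL < xU) :
    GroupTesting.IsEssentiallyComplete p₀ p₁ p₂ (GroupTesting.classC₀ xL xU) ∧
    ∃ s : Fin 6 → ℝ, (∀ i, s i = 1 ∨ s i = -1) ∧
      GroupTesting.IsChebyshevSystem
        (fun i a => s i *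
          GroupTesting.Psi (GroupTesting.cConst p₀ p₁ p₂ xL) (GroupTesting.deltaConst p₁) i a)
        (Set.Icc (GroupTesting.rConst p₀ xL xU) 1) := by
  have hc := GroupTesting.one_lt_cConst hp₀ hp₁.1 hp₂ (zero_lt_one.trans_le hxL)
  have hδ := GroupTesting.deltaConst_nonneg hp₁
  have hr : 0 < GroupTesting.rConst p₀ xL xU := Real.rpow_pos_of_pos (by linarith [hp₀.2]) _
  exact ⟨GroupTesting.isEssentiallyComplete_classC₀ hp₀ hp₁ hp₂ hxL hx,
    GroupTesting.exists_sign_isChebyshevSystem (convex_Icc _ _)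
      (GroupTesting.continuousOn_Psi hc hδ hr) fun t ht htS =>
        GroupTesting.det_Psi_ne_zero hc hδ ht (fun j => hr.trans_le (htS j).1) fun j => (htS j).2⟩
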